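/- Let $q$ range over the prime powers and let $\mathbb{F}_q$ be the field with $q$ elements. Let $\mathrm{Alt}_n(q)$ be the $\mathbb{F}_q$-space of alternating $n\times n$ matrices ($M_{ij}=-M_{ji}$ and $M_{ii}=0$ for all $i,j$). An alternating code is a non-zero $\mathbb{F}_q$-subspace $\mathcal{C}\le \mathrm{Alt}_n(q)$; its minimum distance is the least rank of a non-zero matrix in $\mathcal{C}$. Let $\delta^{\mathrm{Alt}}_q(n\times n,k,d)$ be the proportion of codes of minimum distance at least $d$ among the $k$-dimensional alternating codes in $\mathrm{Alt}_n(q)$. Let $2\le d\le n$ be integers with $d=2e$ even, and put $t=\lfloor n/2\rfloor$. For every integer $k$ with $1\le k\le \frac{n(n-1)}{2t}(t-e+1)$ we have $$\delta^{\mathrm{Alt}}_q(n\times n,k,d)\in O\left(q^{\,n(n-1)/2-k+1-(d-2)n+(d-1)(d-2)/2}\right)\quad\text{as } q\to+\infty,$$ and $$\lim_{q\to+\infty}\delta^{\mathrm{Alt}}_q(n\times n,k,d)=\begin{cases}1 & \text{if } k<\frac{n(n-1)}{2}+1-(d-2)n+\frac{(d-1)(d-2)}{2},\\[2pt] 0 &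 \text{if } k>\frac{n(n-1)}{2}+1-(d-2)n+\frac{(d-1)(d-2)}{2}.\end{cases}$$ In particular, alternating MRD codes are sparse for $d\ge 4$: if $d\ge 4$ and $k=\frac{n(n-1)}{2t}(t-e+1)$, then $\delta^{\mathrm{Alt}}_q(n\times n,k,d)\to 0$ as $q\to+\infty$, and so does the proportion, among the $k$-dimensional alternating codes in $\mathrm{Alt}_n(q)$, of the alternating MRD codes of minimum distance $d$. Here an alternating code of minimum distance $2e'$ is called MRD if its dimension equals $\frac{n(n-1)}{2t}(t-e'+1)$. -/

import Mathlib

open Filter Topology Asymptotics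

/-- The alternating `n × n` matrices over `F`: skew-symmetric with zero diagonal. -/
def altMatrices (F : Type*) [Field F] (n : ℕ) : Submodule F (Matrix (Fin n) (Fin n) F) where
  carrier := {M | (∀ i j, M i j = -M j i) ∧ ∀ i, M i i = 0}
  zero_mem' := by simp
  add_mem' := by
    rintro A B ⟨hA, hA'⟩ ⟨hB, hB'⟩
    refine ⟨fun i j => ?_, fun i => by simp [hA' i, hB' i]⟩
    rw [Matrix.add_apply, Matrix.add_apply, hA i j, hB i j, neg_add]
  smul_mem' := by
    rintro c A ⟨hA, hA'⟩
    refine ⟨fun i j => ?_, fun i => by simp [hA' i]⟩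
    rw [Matrix.smul_apply, Matrix.smul_apply, hA i j, smul_neg]

/-- An alternating rank-metric code: a non-zero `F`-linear space of alternating matrices. -/
def IsAltCode {F : Type*} [Field F] {n : ℕ} (C : Submodule F (Matrix (Fin n) (Fin n) F)) : Prop :=
  C ≠ ⊥ ∧ C ≤ altMatrices F n

/-- The minimum distance of a (non-zero) code: the least rank of a non-zero matrix in it. -/
noncomputable def minDist {F : Type*} [Field F] {n : ℕ}
    (C : Submodule F (Matrix (Fin n) (Fin n) F)) : ℕ :=
  sInf {r : ℕ | ∃ M ∈ C, M ≠ 0 ∧ M.rank = r}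

/-- The set of `k`-dimensional alternating codes. -/
def altCodes (F : Type*) [Field F] (n k : ℕ) : Set (Submodule F (Matrix (Fin n) (Fin n) F)) :=
  {C | IsAltCode C ∧ Module.finrank F C = k}

/-- The proportion of codes of minimum distance at least `d` among the `k`-dimensional
alternating codes. -/
noncomputable def altDensity (F : Type*) [Field F] (n k d : ℕ) : ℝ :=
  ({C ∈ altCodes F n k | d ≤ minDist C}.ncard : ℝ) / ((altCodes F n k).ncard : ℝ)

/-- The real number `n(n-1)/(2t) * (t-e+1)` with `t = ⌊n/2⌋` (for `n ≥ 2`). -/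
noncomputable def altBound (n e : ℕ) : ℝ :=
  (n : ℝ) * (n - 1) / (2 * ((n / 2 : ℕ) : ℝ)) * (((n / 2 : ℕ) : ℝ) - e + 1)

/-- An alternating MRD code: an alternating code of some minimum distance `2e` whose dimension
equals `n(n-1)/(2t) * (t-e+1)`. -/
def IsAltMRD {F : Type*} [Field F] {n : ℕ} (C : Submodule F (Matrix (Fin n) (Fin n) F)) : Prop :=
  IsAltCode C ∧ ∃ e : ℕ, minDist C = 2 * e ∧ (Module.finrank F C : ℝ) = altBound n e

/-- The proportion of alternating MRD codes of minimum distance `d` among the `k`-dimensional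
alternating codes. -/
noncomputable def altMRDDensity (F : Type*) [Field F] (n k d : ℕ) : ℝ :=
  ({C ∈ altCodes F n k | IsAltMRD C ∧ minDist C = d}.ncard : ℝ) / ((altCodes F n k).ncard : ℝ)

/-- The prime powers, over which the limit `q → ∞` (the filter `atTop`) is taken. -/
abbrev PrimePower : Type := {q : ℕ // IsPrimePow q}

/-- The number `n(n-1)/2 + 1 - (d-2)n + (d-1)(d-2)/2`. -/
noncomputable def altThreshold (n d : ℕ) : ℝ :=
  (n : ℝ) * (n - 1) / 2 + 1 - ((d : ℝ) - 2) * n + ((d : ℝ) - 1) * ((d : ℝ) - 2) / 2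

/-! The proof tests whether a random `k`-dimensional code contains a matrix of too small a rank, by
a first and a second moment. Write `N = n(n-1)/2`, `d = 2s+2`, `n = 2s+u`, and let `B` be the set of
non-zero alternating matrices of rank less than `d`. For `s ≥ 1`, `B` has order of magnitude `q^E`
with `E = s(2n-2s-1)`, so it consists of about `q^(E-1)` punctured lines. Each line lies in a random
code with probability about `q^(k-N)`, so the expected number of bad lines is about `q^(k-T)`, where
`T = N+1-E` is exactly `altThreshold n d`.

If `k < T`, Markov's inequality (`first_moment_bound`) makes a bad line unlikely. If `k > T`,
Chebyshev's inequality (`second_moment_bound`) makes a code without bad lines unlikely: membership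
of independent vectors is negatively correlated, so the variance comes only from proportional pairs,
and the density is `O(q^(T-k))`.

The size of `B` is found by splitting off hyperbolic planes: `card_altRankLE_le` and
`le_card_altRankLE` bound it on both sides, up to constants independent of `q`. Sparsity of MRD
codes then reduces to `altThreshold_lt_altBound`, since the MRD dimension exceeds `T` once `d ≥ 4`.
-/

theorem exists_linearEquiv_comp_eq {K V ι : Type*} [Field K] [AddCommGroup V] [Module K V]
    [FiniteDimensional K V] {s t : ι → V} (hs : LinearIndependent K s)
    (ht : LinearIndependent K t) : ∃ g : V ≃ₗ[K] V, ∀ i, g (s i) = t i := by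
  obtain ⟨g, hg⟩ := Submodule.exists_linearEquiv_restrict_eq
    (hs.linearCombinationEquiv.symm ≪≫ₗ ht.linearCombinationEquiv)
  refine ⟨g, fun i => ?_⟩
  have := hg ⟨s i, Submodule.subset_span ⟨i, rfl⟩⟩
  rw [← this]
  change (ht.linearCombinationEquiv (hs.repr _) : V) = _
  rw [hs.repr_eq_single i _ rfl]
  simp

/-! ### Random subspaces of a finite vector space: first and second moments. -/

section Counting

variable {K V : Type*} [Field K] [Fintype K] [AddCommGroup V] [Module K V] [Fintype V]

open Classical in
/-- The `k`-dimensional subspaces of a finite vector space. -/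
noncomputable def grassmannian (K V : Type*) [Field K] [AddCommGroup V] [Module K V] [Fintype V]
    (k : ℕ) : Finset (Submodule K V) :=
  Finset.univ.filter fun C => Module.finrank K C = k

omit [Fintype K] in
theorem mem_grassmannian {k : ℕ} {C : Submodule K V} :
    C ∈ grassmannian K V k ↔ Module.finrank K C = k := by
  simp [grassmannian]

omit [Fintype K] in
theorem grassmannian_nonempty {k : ℕ} (hk : k ≤ Module.finrank K V) :
    (grassmannian K V k).Nonempty := by
  let b := Module.finBasis K V
  have hli : LinearIndependent K (b ∘ Fin.castLE hk) :=
    b.linearIndependent.comp _ (Fin.castLE_injective hk)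
  refine ⟨Submodule.span K (Set.range (b ∘ Fin.castLE hk)), ?_⟩
  rw [mem_grassmannian, finrank_span_eq_card hli, Fintype.card_fin]

theorem natCard_linearIndependent (m : ℕ) :
    (Nat.card {s : Fin m → V // LinearIndependent K s} : ℝ) =
      ∏ i : Fin m, ((Fintype.card K : ℝ) ^ Module.finrank K V - (Fintype.card K : ℝ) ^ (i : ℕ)) := by
  by_cases hm : m ≤ Module.finrank K V
  · rw [card_linearIndependent hm]
    push_cast
    refine Finset.prod_congr rfl fun i _ => ?_
    rw [Nat.cast_sub (Nat.pow_le_pow_right Fintype.card_pos (i.2.le.trans hm))]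
    push_cast; rfl
  · push Not at hm
    rw [Finset.prod_eq_zero (Finset.mem_univ (⟨_, hm⟩ : Fin m)) (by simp)]
    have : IsEmpty {s : Fin m → V // LinearIndependent K s} := by
      refine ⟨fun s => ?_⟩
      have := s.2.fintype_card_le_finrank
      simp at this; omega
    simp

open Classical in
theorem card_linearIndependent_mem (C : Submodule K V) (m : ℕ) :
    (((Finset.univ.filter fun s : Fin m → V => LinearIndependent K s).filter
      fun s => ∀ i, s i ∈ C).card : ℝ) =
      ∏ i : Fin m, ((Fintype.card K : ℝ) ^ Module.finrank K C - (Fintype.card K : ℝ) ^ (i : ℕ)) := by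
  rw [← natCard_linearIndependent (K := K) (V := C) m, Nat.card_eq_fintype_card,
    Fintype.card_subtype]
  congr 1
  symm
  refine Finset.card_bij (fun s _ i => (s i : V)) ?_ ?_ ?_
  · intro s hs
    simp only [Finset.mem_filter, Finset.mem_univ, true_and] at hs ⊢
    exact ⟨hs.map' C.subtype C.ker_subtype, fun i => (s i).2⟩
  · intro s _ t _ h
    funext i
    exact Subtype.ext (congrFun h i)
  · intro s hs
    simp only [Finset.mem_filter, Finset.mem_univ, true_and] at hs
    refine ⟨fun i => ⟨s i, hs.2 i⟩, ?_, rfl⟩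
    simp only [Finset.mem_filter, Finset.mem_univ, true_and]
    exact LinearIndependent.of_comp C.subtype hs.1

omit [Fintype K] in
open Classical in
-- The general linear group is transitive on independent families of a given length and permutes the
-- `k`-dimensional subspaces.
theorem card_grassmannian_filter_mem_congr {m : ℕ} {s t : Fin m → V} (k : ℕ)
    (hs : LinearIndependent K s) (ht : LinearIndependent K t) :
    ((grassmannian K V k).filter fun C => ∀ i, s i ∈ C).card =
      ((grassmannian K V k).filter fun C => ∀ i, t i ∈ C).card := by
  obtain ⟨g, hg⟩ := exists_linearEquiv_comp_eq hs ht
  refine Finset.card_equiv (Submodule.orderIsoMapComap g).toEquiv fun C => ?_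
  simp only [Finset.mem_filter, mem_grassmannian]
  refine and_congr ?_ (forall_congr' fun i => ?_)
  · have : Module.finrank K (C.map (g : V →ₗ[K] V)) = Module.finrank K C :=
      LinearEquiv.finrank_map_eq g C
    exact (this ▸ Iff.rfl)
  · change s i ∈ C ↔ t i ∈ C.map (g : V →ₗ[K] V)
    rw [← hg i]
    simp

open Classical in
-- Double counting of pairs (independent family, subspace containing it); by transitivity every
-- family contributes equally. Stated as a product, so that no denominator has to be non-zero.
theorem card_grassmannian_filter_mem_mul {m : ℕ} {s : Fin m → V} (k : ℕ)
    (hs : LinearIndependent K s) :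
    (((grassmannian K V k).filter fun C => ∀ i, s i ∈ C).card : ℝ) *
      ∏ i : Fin m, ((Fintype.card K : ℝ) ^ Module.finrank K V - (Fintype.card K : ℝ) ^ (i : ℕ)) =
    (grassmannian K V k).card *
      ∏ i : Fin m, ((Fintype.card K : ℝ) ^ k - (Fintype.card K : ℝ) ^ (i : ℕ)) := by
  have key := Finset.sum_card_bipartiteAbove_eq_sum_card_bipartiteBelow
    (s := Finset.univ.filter fun s : Fin m → V => LinearIndependent K s)
    (t := grassmannian K V k) (fun s C => ∀ i, s i ∈ C)
  have h1 := congrArg (Nat.cast : ℕ → ℝ) key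
  rw [Nat.cast_sum, Nat.cast_sum] at h1
  simp only [Finset.bipartiteAbove, Finset.bipartiteBelow] at h1
  have h2 : ∀ t ∈ Finset.univ.filter fun s : Fin m → V => LinearIndependent K s,
      (((grassmannian K V k).filter fun C => ∀ i, t i ∈ C).card : ℝ) =
        ((grassmannian K V k).filter fun C => ∀ i, s i ∈ C).card := fun t ht =>
    congrArg _ (card_grassmannian_filter_mem_congr k (Finset.mem_filter.1 ht).2 hs)
  rw [Finset.sum_congr rfl h2, Finset.sum_congr rfl fun C hC => (card_linearIndependent_mem C m).trans
      (by rw [mem_grassmannian.1 hC])] at h1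
  rw [Finset.sum_const, Finset.sum_const, nsmul_eq_mul, nsmul_eq_mul, ← Fintype.card_subtype,
    ← Nat.card_eq_fintype_card, natCard_linearIndependent] at h1
  rw [mul_comm, h1]

open Classical in
theorem card_grassmannian_filter_mem_single {v : V} (k : ℕ) (hv : v ≠ 0) :
    (((grassmannian K V k).filter fun C => v ∈ C).card : ℝ) *
      ((Fintype.card K : ℝ) ^ Module.finrank K V - 1) =
    (grassmannian K V k).card * ((Fintype.card K : ℝ) ^ k - 1) := by
  have hs : LinearIndependent K ![v] := LinearIndependent.of_subsingleton 0 (by simpa using hv)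
  simpa using card_grassmannian_filter_mem_mul k hs

open Classical in
theorem card_grassmannian_filter_mem_pair {v w : V} (k : ℕ) (h : LinearIndependent K ![v, w]) :
    (((grassmannian K V k).filter fun C => v ∈ C ∧ w ∈ C).card : ℝ) *
      (((Fintype.card K : ℝ) ^ Module.finrank K V - 1) *
        ((Fintype.card K : ℝ) ^ Module.finrank K V - Fintype.card K)) =
    (grassmannian K V k).card *
      (((Fintype.card K : ℝ) ^ k - 1) * ((Fintype.card K : ℝ) ^ k - Fintype.card K)) := by
  simpa [Fin.prod_univ_two, Fin.forall_fin_two] using card_grassmannian_filter_mem_mul k h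

open Classical in
/-- The `k`-dimensional subspaces that meet `B` trivially. -/
noncomputable def avoiding (K : Type*) {V : Type*} [Field K] [AddCommGroup V] [Module K V]
    [Fintype V] (k : ℕ) (B : Finset V) : Finset (Submodule K V) :=
  (grassmannian K V k).filter fun C => ∀ v ∈ B, v ∉ C

omit [Fintype K] in
theorem mem_avoiding {k : ℕ} {B : Finset V} {C : Submodule K V} :
    C ∈ avoiding K k B ↔ Module.finrank K C = k ∧ ∀ v ∈ B, v ∉ C := by
  simp [avoiding, mem_grassmannian]

open Classical in
theorem sum_card_filter_mem_mul (k : ℕ) {B : Finset V} (hB : ∀ v ∈ B, v ≠ 0) :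
    (∑ C ∈ grassmannian K V k, ((B.filter fun v => v ∈ C).card : ℝ)) *
      ((Fintype.card K : ℝ) ^ Module.finrank K V - 1) =
    B.card * ((grassmannian K V k).card * ((Fintype.card K : ℝ) ^ k - 1)) := by
  have key := Finset.sum_card_bipartiteAbove_eq_sum_card_bipartiteBelow
    (s := B) (t := grassmannian K V k) (fun v C => v ∈ C)
  have h1 := congrArg (Nat.cast : ℕ → ℝ) key
  rw [Nat.cast_sum, Nat.cast_sum] at h1
  simp only [Finset.bipartiteAbove, Finset.bipartiteBelow] at h1
  rw [← h1, Finset.sum_mul, Finset.sum_congr rfl fun v hv =>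
    card_grassmannian_filter_mem_single k (hB v hv), Finset.sum_const, nsmul_eq_mul]

open Classical in
/-- First moment bound for the subspaces meeting a set closed under scaling. -/
theorem first_moment_bound (k : ℕ) {B : Finset V} (hB : ∀ v ∈ B, v ≠ 0)
    (hsmul : ∀ v ∈ B, ∀ c : K, c ≠ 0 → c • v ∈ B) :
    (((grassmannian K V k).card : ℝ) - (avoiding K k B).card) * ((Fintype.card K : ℝ) - 1) *
      ((Fintype.card K : ℝ) ^ Module.finrank K V - 1) ≤
    (grassmannian K V k).card * (B.card * ((Fintype.card K : ℝ) ^ k - 1)) := by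
  have hq : (1 : ℝ) ≤ Fintype.card K := by exact_mod_cast Fintype.card_pos
  have hQ : (0 : ℝ) ≤ (Fintype.card K : ℝ) ^ Module.finrank K V - 1 :=
    sub_nonneg.2 (one_le_pow₀ hq)
  have hsub : avoiding K k B ⊆ grassmannian K V k := Finset.filter_subset _ _
  have h1 : (((grassmannian K V k).card : ℝ) - (avoiding K k B).card) *
      ((Fintype.card K : ℝ) - 1) ≤
      ∑ C ∈ grassmannian K V k, ((B.filter fun v => v ∈ C).card : ℝ) := by
    rw [← Nat.cast_sub (Finset.card_le_card hsub), ← Finset.card_sdiff_of_subset hsub,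
      ← nsmul_eq_mul, ← Finset.sum_const]
    refine (Finset.sum_le_sum fun C hC => ?_).trans
      (Finset.sum_le_sum_of_subset_of_nonneg Finset.sdiff_subset fun _ _ _ => Nat.cast_nonneg _)
    obtain ⟨hC, hCn⟩ := Finset.mem_sdiff.1 hC
    simp only [avoiding, Finset.mem_filter, hC, true_and] at hCn
    push Not at hCn
    obtain ⟨v, hv, hvC⟩ := hCn
    -- A subspace meeting `B` contains a whole punctured line of `B`, hence at least `q - 1` of its
    -- elements; this gains the factor `q - 1` over the plain union bound.
    rw [← Nat.cast_one, ← Nat.cast_sub Fintype.card_pos, Nat.cast_le, ← Fintype.card_units,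
      ← Finset.card_univ]
    refine Finset.card_le_card_of_injOn (fun c : Kˣ => (c : K) • v) ?_ ?_
    · intro c _
      simp only [Finset.coe_filter, Set.mem_ofPred_eq]
      exact ⟨hsmul v hv _ c.ne_zero, C.smul_mem _ hvC⟩
    · intro c _ c' _ h
      exact Units.ext (smul_left_injective K (hB v hv) h)
  calc _ ≤ _ := mul_le_mul_of_nonneg_right h1 hQ
    _ = _ := sum_card_filter_mem_mul k hB
    _ = _ := by ring

omit [Fintype V] in
open Classical in
theorem card_filter_not_linearIndependent_pair_le {B : Finset V} (hB : ∀ v ∈ B, v ≠ 0) {v : V}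
    (hv : v ≠ 0) :
    (B.filter fun w => ¬ LinearIndependent K ![v, w]).card ≤ Fintype.card K - 1 := by
  rw [← Fintype.card_units, ← Finset.card_univ]
  refine (Finset.card_le_card fun w hw => ?_).trans
    (Finset.card_image_le (f := fun c : Kˣ => (c : K) • v))
  rw [Finset.mem_filter, LinearIndependent.pair_iff' hv] at hw
  push Not at hw
  obtain ⟨hw, a, rfl⟩ := hw
  have ha : a ≠ 0 := fun h => hB _ hw (by simp [h])
  exact Finset.mem_image.2 ⟨Units.mk0 a ha, Finset.mem_univ _, rfl⟩

open Classical in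
-- Negative correlation: `(q^k - q)/(q^N - q) ≤ (q^k - 1)/(q^N - 1)` for `k ≤ N`, where `N` is the
-- dimension of `V`.
theorem card_grassmannian_filter_mem_pair_le {v w : V} {k : ℕ} (hk : k ≤ Module.finrank K V)
    (h : LinearIndependent K ![v, w]) :
    (((grassmannian K V k).filter fun C => v ∈ C ∧ w ∈ C).card : ℝ) ≤
    (grassmannian K V k).card * (((Fintype.card K : ℝ) ^ k - 1) /
      ((Fintype.card K : ℝ) ^ Module.finrank K V - 1)) ^ 2 := by
  have hq : (1 : ℝ) < Fintype.card K := by exact_mod_cast Fintype.one_lt_card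
  have h2 : 2 ≤ Module.finrank K V := by simpa using h.fintype_card_le_finrank
  have hp := card_grassmannian_filter_mem_pair k h
  set q : ℝ := (Fintype.card K : ℝ) with hqdef
  have hN : q < q ^ Module.finrank K V := lt_self_pow₀ hq h2
  have hkN : q ^ k ≤ q ^ Module.finrank K V := pow_le_pow_right₀ hq.le hk
  have hk1 : 1 ≤ q ^ k := one_le_pow₀ hq.le
  set Q := q ^ Module.finrank K V
  have e1 : 0 < Q - 1 := by linarith
  have e2 : 0 < Q - q := by linarith
  rw [← eq_div_iff (by positivity)] at hp
  rw [hp, mul_div_assoc]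
  refine mul_le_mul_of_nonneg_left ?_ (Nat.cast_nonneg _)
  rw [sq, mul_div_mul_comm]
  refine mul_le_mul_of_nonneg_left ?_ (div_nonneg (by linarith) e1.le)
  rw [div_le_div_iff₀ e2 e1]
  nlinarith [mul_nonneg (sub_nonneg.2 hkN) (sub_nonneg.2 hq.le)]

open Classical in
/-- Second moment bound for the subspaces avoiding a set of nonzero vectors. -/
theorem second_moment_bound {k : ℕ} (hk : k ≤ Module.finrank K V) (hN : 0 < Module.finrank K V)
    {B : Finset V} (hB : ∀ v ∈ B, v ≠ 0) :
    ((avoiding K k B).card : ℝ) * (B.card * ((Fintype.card K : ℝ) ^ k - 1)) ≤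
    (grassmannian K V k).card * (((Fintype.card K : ℝ) - 1) *
      ((Fintype.card K : ℝ) ^ Module.finrank K V - 1)) := by
  have hq : (1 : ℝ) < Fintype.card K := by exact_mod_cast Fintype.one_lt_card
  have hQ : (0 : ℝ) < (Fintype.card K : ℝ) ^ Module.finrank K V - 1 :=
    sub_pos.2 (one_lt_pow₀ hq hN.ne')
  have hk1 : 0 ≤ (Fintype.card K : ℝ) ^ k - 1 := sub_nonneg.2 (one_le_pow₀ hq.le)
  set S := grassmannian K V k with hS
  set p : ℝ := ((Fintype.card K : ℝ) ^ k - 1) / ((Fintype.card K : ℝ) ^ Module.finrank K V - 1)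
    with hp
  have hp0 : 0 ≤ p := div_nonneg hk1 hQ.le
  -- `Y` is the random variable counting the elements of `B` in `C`; its mean is `|B| p`.
  let Y : Submodule K V → ℝ := fun C => ((B.filter fun v => v ∈ C).card : ℝ)
  have hsum : ∑ C ∈ S, Y C = B.card * (S.card * p) := by
    have := sum_card_filter_mem_mul (K := K) k hB
    rw [← eq_div_iff hQ.ne'] at this
    rw [this, hp]; ring
  have hsq : ∑ C ∈ S, Y C ^ 2 ≤
      B.card * (((Fintype.card K : ℝ) - 1) * (S.card * p) + B.card * (S.card * p ^ 2)) := by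
    have hexp : ∑ C ∈ S, Y C ^ 2 =
        ∑ v ∈ B, ∑ w ∈ B, ((S.filter fun C => v ∈ C ∧ w ∈ C).card : ℝ) := by
      simp only [Y, Finset.card_filter, Nat.cast_sum, sq, Finset.sum_mul_sum]
      rw [Finset.sum_comm]
      refine Finset.sum_congr rfl fun v _ => ?_
      rw [Finset.sum_comm]
      refine Finset.sum_congr rfl fun w _ => Finset.sum_congr rfl fun C _ => ?_
      by_cases h1 : v ∈ C <;> by_cases h2 : w ∈ C <;> simp [h1, h2]
    rw [hexp, ← nsmul_eq_mul B.card]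
    refine Finset.sum_le_card_nsmul _ _ _ fun v hv => ?_
    -- For fixed `v`, at most `q - 1` vectors `w` are proportional to it, each contributing at most
    -- `|S| p`; every other `w` contributes at most `|S| p^2`.
    rw [← Finset.sum_filter_not_add_sum_filter B (fun w => LinearIndependent K ![v, w])]
    refine add_le_add ?_ ?_
    · have hc1 : ((S.filter fun C => v ∈ C).card : ℝ) = S.card * p := by
        have := card_grassmannian_filter_mem_single (K := K) k (hB v hv)
        rw [← eq_div_iff hQ.ne'] at this
        rw [this, hp]; ring
      calc _ ≤ ∑ w ∈ B with ¬ LinearIndependent K ![v, w], (S.card * p : ℝ) := by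
            refine Finset.sum_le_sum fun w _ => ?_
            rw [← hc1]
            refine Nat.cast_le.2 (Finset.card_le_card fun C hC => ?_)
            rw [Finset.mem_filter] at hC ⊢
            exact ⟨hC.1, hC.2.1⟩
        _ ≤ _ := by
            rw [Finset.sum_const, nsmul_eq_mul]
            refine mul_le_mul_of_nonneg_right ?_ (by positivity)
            rw [← Nat.cast_one, ← Nat.cast_sub Fintype.card_pos, Nat.cast_le]
            exact card_filter_not_linearIndependent_pair_le hB (hB v hv)
    · calc _ ≤ ∑ w ∈ B with LinearIndependent K ![v, w], (S.card * p ^ 2 : ℝ) :=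
            Finset.sum_le_sum fun w hw =>
              card_grassmannian_filter_mem_pair_le hk (Finset.mem_filter.1 hw).2
        _ ≤ _ := by
            rw [Finset.sum_const, nsmul_eq_mul]
            refine mul_le_mul_of_nonneg_right ?_ (by positivity)
            exact_mod_cast Finset.card_filter_le _ _
  -- Chebyshev: on an avoiding subspace `Y = 0`, which deviates from the mean by the full `|B| p`.
  have hlow : ((avoiding K k B).card : ℝ) * (B.card * p) ^ 2 ≤
      ∑ C ∈ S, (Y C - B.card * p) ^ 2 := by
    rw [← nsmul_eq_mul, ← Finset.sum_const]
    refine (Finset.sum_le_sum fun C hC => ?_).trans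
      (Finset.sum_le_sum_of_subset_of_nonneg (Finset.filter_subset _ _) fun _ _ _ => sq_nonneg _)
    have : Y C = 0 := by
      simpa [Y, Finset.filter_eq_empty_iff] using (Finset.mem_filter.1 hC).2
    rw [this]; exact (by ring : _ = _).le
  have hvar : ∑ C ∈ S, (Y C - B.card * p) ^ 2 =
      ∑ C ∈ S, Y C ^ 2 - 2 * (B.card * p) * ∑ C ∈ S, Y C + S.card * (B.card * p) ^ 2 := by
    simp only [sub_sq, Finset.sum_add_distrib, Finset.sum_sub_distrib, Finset.sum_const,
      nsmul_eq_mul, Finset.mul_sum]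
    congr 2
    exact Finset.sum_congr rfl fun C _ => by ring
  -- The terms in `(|B| p)^2` cancel, leaving only the variance from proportional pairs.
  have hfin : ((avoiding K k B).card * (B.card * p)) * (B.card * p) ≤
      (S.card * ((Fintype.card K : ℝ) - 1)) * (B.card * p) := by
    rw [hvar, hsum] at hlow
    nlinarith
  have hmain : ((avoiding K k B).card * (B.card * p) : ℝ) ≤
      S.card * ((Fintype.card K : ℝ) - 1) := by
    rcases (by positivity : 0 ≤ B.card * p).eq_or_lt with h0 | h0
    · rw [← h0, mul_zero]
      exact mul_nonneg (Nat.cast_nonneg _) (by linarith)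
    · exact le_of_mul_le_mul_right hfin h0
  have hpe : (Fintype.card K : ℝ) ^ k - 1 =
      p * ((Fintype.card K : ℝ) ^ Module.finrank K V - 1) := by
    rw [hp, div_mul_cancel₀ _ hQ.ne']
  rw [hpe]
  nlinarith [mul_le_mul_of_nonneg_right hmain hQ.le]

end Counting

/-! ### Rank under addition of a hyperbolic plane. -/

section WedgeRank

variable {F : Type*} [Field F] {n : ℕ}

/-- The alternating matrix `x yᵀ - y xᵀ`. -/
def wedgeMatrix (x y : Fin n → F) : Matrix (Fin n) (Fin n) F :=
  Matrix.vecMulVec x y - Matrix.vecMulVec y x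

theorem wedgeMatrix_apply (x y : Fin n → F) (k l : Fin n) :
    wedgeMatrix x y k l = x k * y l - y k * x l := by
  simp [wedgeMatrix, Matrix.vecMulVec_apply]

theorem mem_altMatrices {M : Matrix (Fin n) (Fin n) F} :
    M ∈ altMatrices F n ↔ (∀ i j, M i j = -M j i) ∧ ∀ i, M i i = 0 := Iff.rfl

theorem wedgeMatrix_mem_altMatrices (x y : Fin n → F) : wedgeMatrix x y ∈ altMatrices F n := by
  rw [mem_altMatrices]
  simp only [wedgeMatrix_apply]
  exact ⟨fun i j => by ring, fun i => by ring⟩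

theorem wedgeMatrix_mulVec (x y v : Fin n → F) :
    (wedgeMatrix x y).mulVec v = (y ⬝ᵥ v) • x - (x ⬝ᵥ v) • y := by
  funext k
  simp only [Matrix.mulVec, dotProduct, wedgeMatrix_apply, Pi.sub_apply, Pi.smul_apply,
    smul_eq_mul, Finset.sum_mul, ← Finset.sum_sub_distrib]
  exact Finset.sum_congr rfl fun l _ => by ring

theorem rank_wedgeMatrix_add_le (x y : Fin n → F) (M : Matrix (Fin n) (Fin n) F) :
    (wedgeMatrix x y + M).rank ≤ M.rank + 2 := by
  have hsub : LinearMap.range (wedgeMatrix x y + M).mulVecLin ≤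
      LinearMap.range M.mulVecLin ⊔ Submodule.span F {x, y} := by
    rintro _ ⟨v, rfl⟩
    rw [Matrix.mulVecLin_apply, Matrix.add_mulVec, wedgeMatrix_mulVec, add_comm]
    refine Submodule.add_mem_sup ⟨v, rfl⟩ (Submodule.sub_mem _ ?_ ?_) <;>
      exact Submodule.smul_mem _ _ (Submodule.subset_span (by simp))
  refine (Submodule.finrank_mono hsub).trans
    ((Submodule.finrank_add_le_finrank_add_finrank _ _).trans (Nat.add_le_add_left ?_ _))
  classical
  refine (finrank_span_le_card _).trans ?_
  rw [Set.toFinset_insert, Set.toFinset_singleton]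
  exact Finset.card_le_two

/-- Both `y` and a multiple of `x` are values of the sum, at `-e_i` and `e_j`, so its range contains
`x`, `y` and the range of `M`. The last vanishes in coordinates `i` and `j`, where `x` and `y` do
not, so two dimensions are gained. -/
theorem rank_add_two_le_rank_wedgeMatrix_add {x y : Fin n → F} {M : Matrix (Fin n) (Fin n) F}
    {i j : Fin n} (hxi : x i = 1) (hxj : x j = 0) (hyi : y i = 0) (hyj : y j ≠ 0)
    (hMi : ∀ k, M i k = 0 ∧ M k i = 0) (hMj : ∀ k, M j k = 0 ∧ M k j = 0) :
    M.rank + 2 ≤ (wedgeMatrix x y + M).rank := by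
  set R := LinearMap.range (wedgeMatrix x y + M).mulVecLin with hR
  have hmul : ∀ v, (wedgeMatrix x y + M).mulVec v =
      (y ⬝ᵥ v) • x - (x ⬝ᵥ v) • y + M.mulVec v := fun v => by
    rw [Matrix.add_mulVec, wedgeMatrix_mulVec]
  have hyR : y ∈ R := by
    refine ⟨-Pi.single i 1, ?_⟩
    rw [Matrix.mulVecLin_apply, hmul]
    funext k
    simp [hyi, hxi, Matrix.mulVec_neg, (hMi k).2]
  have hxR : x ∈ R := by
    refine ⟨(y j)⁻¹ • Pi.single j 1, ?_⟩
    rw [Matrix.mulVecLin_apply, hmul]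
    funext k
    simp [hxj, hyj, Matrix.mulVec_smul, (hMj k).2]
  have hMR : LinearMap.range M.mulVecLin ≤ R := by
    rintro _ ⟨v, rfl⟩
    have h1 : M.mulVecLin v = (wedgeMatrix x y + M).mulVecLin v
        - (y ⬝ᵥ v) • x + (x ⬝ᵥ v) • y := by
      rw [Matrix.mulVecLin_apply, Matrix.mulVecLin_apply, hmul]; abel
    rw [h1]
    exact R.add_mem (R.sub_mem ⟨v, rfl⟩ (R.smul_mem _ hxR)) (R.smul_mem _ hyR)
  have hcoord : ∀ l, (∀ k, M l k = 0) → ∀ z ∈ LinearMap.range M.mulVecLin, z l = 0 := by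
    rintro l hl _ ⟨v, rfl⟩
    simp [Matrix.mulVec, dotProduct, hl]
  let pi : (Fin n → F) →ₗ[F] F := LinearMap.proj i
  let pj : (Fin n → F) →ₗ[F] F := LinearMap.proj j
  have h1 : LinearMap.range M.mulVecLin < R ⊓ LinearMap.ker pj := by
    refine lt_of_le_of_ne (le_inf hMR fun z hz => hcoord j (fun k => (hMj k).1) z hz) fun h => ?_
    have : x ∈ LinearMap.range M.mulVecLin := h ▸ ⟨hxR, hxj⟩
    have := hcoord i (fun k => (hMi k).1) x this
    rw [hxi] at this
    exact one_ne_zero this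
  have h2 : R ⊓ LinearMap.ker pj < R := by
    refine lt_of_le_of_ne inf_le_left fun h => hyj ?_
    have : y ∈ R ⊓ LinearMap.ker pj := h.symm ▸ hyR
    exact this.2
  have h3 := Submodule.finrank_lt_finrank_of_lt h1
  have h4 := Submodule.finrank_lt_finrank_of_lt h2
  change Module.finrank F (LinearMap.range M.mulVecLin) + 2 ≤ Module.finrank F R
  omega

end WedgeRank

/-! ### Counting alternating matrices of bounded rank. -/

section RankCount

variable (F : Type*) [Field F] [Fintype F] {n : ℕ}

open Classical in
/-- The vectors supported on `U`. -/
noncomputable def vectorsOn (U : Finset (Fin n)) : Finset (Fin n → F) :=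
  Finset.univ.filter fun v => ∀ k, k ∉ U → v k = 0

variable {F} in
theorem mem_vectorsOn {U : Finset (Fin n)} {v : Fin n → F} :
    v ∈ vectorsOn F U ↔ ∀ k, k ∉ U → v k = 0 := by
  simp [vectorsOn]

theorem card_vectorsOn (U : Finset (Fin n)) :
    (vectorsOn F U).card = Fintype.card F ^ U.card := by
  classical
  have : vectorsOn F U =
      Fintype.piFinset fun k => if k ∈ U then (Finset.univ : Finset F) else {0} := by
    ext v
    rw [mem_vectorsOn, Fintype.mem_piFinset]
    refine forall_congr' fun k => ?_
    by_cases hk : k ∈ U <;> simp [hk]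
  rw [this, Fintype.card_piFinset]
  simp only [apply_ite Finset.card, Finset.card_univ, Finset.card_singleton]
  rw [Finset.prod_ite_mem, Finset.univ_inter, Finset.prod_const]

open Classical in
/-- The alternating matrices of rank at most `r` whose rows (and columns) outside `T` vanish. -/
noncomputable def altRankLE (T : Finset (Fin n)) (r : ℕ) : Finset (Matrix (Fin n) (Fin n) F) :=
  Finset.univ.filter fun M => M ∈ altMatrices F n ∧ (∀ k, k ∉ T → ∀ l, M k l = 0) ∧ M.rank ≤ r

variable {F}

theorem mem_altRankLE {T : Finset (Fin n)} {r : ℕ} {M : Matrix (Fin n) (Fin n) F} :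
    M ∈ altRankLE F T r ↔
      M ∈ altMatrices F n ∧ (∀ k, k ∉ T → ∀ l, M k l = 0) ∧ M.rank ≤ r := by
  simp [altRankLE]

/-- Splitting off a hyperbolic plane from an alternating matrix with a nonzero entry. -/
theorem exists_wedgeMatrix_add {T : Finset (Fin n)} {M : Matrix (Fin n) (Fin n) F}
    (hM : M ∈ altMatrices F n) (hT : ∀ k, k ∉ T → ∀ l, M k l = 0) {i j : Fin n}
    (hij : M i j ≠ 0) :
    ∃ y ∈ vectorsOn F (T.erase i), ∃ z ∈ vectorsOn F ((T.erase i).erase j),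
      ∃ M' ∈ altRankLE F ((T.erase i).erase j) (M.rank - 2),
        M = wedgeMatrix (Pi.single i 1 + z) y + M' ∧ M'.rank + 2 ≤ M.rank := by
  obtain ⟨hskew, hdiag⟩ := hM
  have hne : i ≠ j := fun h => hij (h ▸ hdiag i)
  have hcol : ∀ k, k ∉ T → ∀ l, M l k = 0 := fun k hk l => by rw [hskew, hT k hk, neg_zero]
  set a := M i j with ha
  have hji : M j i = -a := hskew j i
  -- With this scaling, rows `i` and `j` of `wedgeMatrix x y` agree with those of `M`, so the
  -- remainder vanishes there.
  set x : Fin n → F := fun k => -a⁻¹ * M j k with hx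
  set y : Fin n → F := fun k => M i k with hy
  have hxi : x i = 1 := by simp [hx, hji, hij]
  have hxj : x j = 0 := by simp [hx, hdiag]
  have hyi : y i = 0 := hdiag i
  have hyj : y j = a := rfl
  set M' := M - wedgeMatrix x y with hM'
  have hMM : M = wedgeMatrix x y + M' := by rw [hM']; abel
  have halt : M' ∈ altMatrices F n :=
    Submodule.sub_mem _ ⟨hskew, hdiag⟩ (wedgeMatrix_mem_altMatrices x y)
  have happ : ∀ k l, M' k l = M k l - (x k * y l - y k * x l) := fun k l => by
    rw [hM', Matrix.sub_apply, wedgeMatrix_apply]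
  have hi : ∀ l, M' i l = 0 := fun l => by rw [happ, hxi, hyi]; simp [hy]
  have hj : ∀ l, M' j l = 0 := fun l => by
    rw [happ, hxj, hyj]; simp [hx, mul_inv_cancel_left₀ hij]
  have hi' : ∀ l, M' l i = 0 := fun l => by rw [halt.1, hi, neg_zero]
  have hj' : ∀ l, M' l j = 0 := fun l => by rw [halt.1, hj, neg_zero]
  have hrank : M'.rank + 2 ≤ M.rank := by
    conv_rhs => rw [hMM]
    exact rank_add_two_le_rank_wedgeMatrix_add hxi hxj hyi (hyj ▸ hij)
      (fun k => ⟨hi k, hi' k⟩) (fun k => ⟨hj k, hj' k⟩)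
  refine ⟨y, ?_, x - Pi.single i 1, ?_, M', ?_, by rwa [add_sub_cancel], hrank⟩
  · rw [mem_vectorsOn]
    intro k hk
    by_cases hki : k = i
    · rw [hki, hyi]
    · exact hcol k (fun h => hk (Finset.mem_erase.2 ⟨hki, h⟩)) i
  · rw [mem_vectorsOn]
    intro k hk
    by_cases hki : k = i
    · simp [hki, hxi]
    · by_cases hkj : k = j
      · simp [hkj, hxj, hne.symm]
      · have := hcol k (fun h => hk (Finset.mem_erase.2 ⟨hkj, Finset.mem_erase.2 ⟨hki, h⟩⟩)) j
        simp [hx, hki, this]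
  · rw [mem_altRankLE]
    refine ⟨halt, fun k hk l => ?_, by omega⟩
    by_cases hki : k = i
    · rw [hki, hi]
    · by_cases hkj : k = j
      · rw [hkj, hj]
      · have hkT : k ∉ T := fun h => hk (Finset.mem_erase.2 ⟨hkj, Finset.mem_erase.2 ⟨hki, h⟩⟩)
        rw [happ, hT k hkT]
        simp [hx, hy, hcol k hkT]

/-- The dimension of the variety of alternating matrices of size `2 s + u` and rank at
most `2 s`. -/
def altRankDim (u : ℕ) : ℕ → ℕ
  | 0 => 0
  | s + 1 => 2 * u + 4 * s + 1 + altRankDim u s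

theorem altRankDim_add (u s : ℕ) : altRankDim u s + s = 2 * s * (s + u) := by
  induction s with
  | zero => simp [altRankDim]
  | succ s ih => rw [altRankDim]; nlinarith

theorem card_erase_erase {T : Finset (Fin n)} {i j : Fin n} (hi : i ∈ T) (hj : j ∈ T)
    (hij : i ≠ j) : ((T.erase i).erase j).card + 2 = T.card := by
  have h1 := Finset.card_erase_add_one hi
  have h2 := Finset.card_erase_add_one (Finset.mem_erase.2 ⟨hij.symm, hj⟩)
  omega

/-- Induction by splitting off a plane at a pivot `(i, j)`: `y` and `z` have `2s+u+1` and `2s+u`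
free coordinates, which is the increment of `altRankDim`. Allowing rank `2s+1` costs nothing, as
each split lowers the rank by at least two and rank at most one forces zero. The factor `n^2 + 1`
counts the pivots and the zero matrix. -/
theorem card_altRankLE_le (u s : ℕ) : ∀ T : Finset (Fin n), T.card = 2 * s + u →
    (altRankLE F T (2 * s + 1)).card ≤ (n ^ 2 + 1) ^ s * Fintype.card F ^ altRankDim u s := by
  classical
  induction s with
  | zero =>
    intro T _
    simp only [altRankDim, pow_zero, mul_one]
    rw [Finset.card_le_one_iff_subset_singleton]
    refine ⟨0, fun M hM => ?_⟩
    rw [mem_altRankLE] at hM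
    rw [Finset.mem_singleton]
    by_contra hne
    obtain ⟨i, j, hij⟩ : ∃ i j, M i j ≠ 0 := by
      by_contra! h
      exact hne (Matrix.ext h)
    obtain ⟨_, _, _, _, _, _, _, h⟩ := exists_wedgeMatrix_add hM.1 hM.2.1 hij
    omega
  | succ s ih =>
    intro T hT
    set q := Fintype.card F with hq
    have hq1 : 1 ≤ q := Fintype.card_pos
    let P : Fin n × Fin n → Finset (Matrix (Fin n) (Fin n) F) := fun p =>
      ((vectorsOn F (T.erase p.1)) ×ˢ ((vectorsOn F ((T.erase p.1).erase p.2)) ×ˢ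
        (altRankLE F ((T.erase p.1).erase p.2) (2 * s + 1)))).image
        fun w => wedgeMatrix (Pi.single p.1 1 + w.2.1) w.1 + w.2.2
    let I : Finset (Fin n × Fin n) := Finset.univ.filter fun p => p.1 ∈ T ∧ p.2 ∈ T ∧ p.1 ≠ p.2
    have hcover : altRankLE F T (2 * (s + 1) + 1) ⊆ insert 0 (I.biUnion P) := by
      intro M hM
      rw [mem_altRankLE] at hM
      rw [Finset.mem_insert]
      by_cases hne : M = 0
      · exact Or.inl hne
      right
      obtain ⟨i, j, hij⟩ : ∃ i j, M i j ≠ 0 := by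
        by_contra! h
        exact hne (Matrix.ext h)
      have hiT : i ∈ T := by
        by_contra h; exact hij (hM.2.1 i h j)
      have hjT : j ∈ T := by
        by_contra h; exact hij (by rw [hM.1.1, hM.2.1 j h, neg_zero])
      have hne' : i ≠ j := by rintro rfl; exact hij (hM.1.2 i)
      obtain ⟨y, hy, z, hz, M', hM', hMM, hr⟩ := exists_wedgeMatrix_add hM.1 hM.2.1 hij
      refine Finset.mem_biUnion.2 ⟨(i, j), by simp [I, hiT, hjT, hne'], ?_⟩
      refine Finset.mem_image.2 ⟨(y, z, M'), ?_, hMM.symm⟩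
      refine Finset.mem_product.2 ⟨hy, Finset.mem_product.2 ⟨hz, ?_⟩⟩
      rw [mem_altRankLE] at hM' ⊢
      exact ⟨hM'.1, hM'.2.1, by have := hM.2.2; dsimp only; omega⟩
    have hP : ∀ p ∈ I, (P p).card ≤ (n ^ 2 + 1) ^ s * q ^ altRankDim u (s + 1) := by
      rintro ⟨i, j⟩ hp
      simp only [I, Finset.mem_filter, Finset.mem_univ, true_and] at hp
      obtain ⟨hi, hj, hij⟩ := hp
      have hc := card_erase_erase hi hj hij
      have hc1 := Finset.card_erase_add_one hi
      refine Finset.card_image_le.trans ?_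
      rw [Finset.card_product, Finset.card_product, card_vectorsOn, card_vectorsOn]
      refine (Nat.mul_le_mul_left _ (Nat.mul_le_mul_left _
        (ih ((T.erase i).erase j) (by omega)))).trans (le_of_eq ?_)
      rw [show (T.erase i).card = 2 * s + u + 1 by omega,
        show ((T.erase i).erase j).card = 2 * s + u by omega, altRankDim, ← hq]
      ring
    have hI : I.card ≤ n ^ 2 := by
      refine (Finset.card_le_univ _).trans ?_
      simp [sq]
    calc _ ≤ (I.biUnion P).card + 1 := (Finset.card_le_card hcover).trans (Finset.card_insert_le _ _)
      _ ≤ I.card * ((n ^ 2 + 1) ^ s * q ^ altRankDim u (s + 1)) + 1 :=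
          Nat.add_le_add_right (Finset.card_biUnion_le_card_mul _ _ _ hP) _
      _ ≤ n ^ 2 * ((n ^ 2 + 1) ^ s * q ^ altRankDim u (s + 1)) +
          (n ^ 2 + 1) ^ s * q ^ altRankDim u (s + 1) :=
          Nat.add_le_add (Nat.mul_le_mul_right _ hI)
            (Nat.mul_pos (by positivity) (by positivity))
      _ = _ := by ring

/-- With the pivot fixed the splitting is unique: row `i` reveals `a` and `w`, then row `j` reveals
`z`. -/
theorem wedgeMatrix_add_injective {i j : Fin n} (hij : i ≠ j) {U : Finset (Fin n)} (hi : i ∉ U)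
    (hj : j ∉ U) {a a' : F} (ha : a ≠ 0) {z z' w w' : Fin n → F} (hz : z ∈ vectorsOn F U)
    (hz' : z' ∈ vectorsOn F U) (hw : w ∈ vectorsOn F U) (hw' : w' ∈ vectorsOn F U)
    {M M' : Matrix (Fin n) (Fin n) F} (hM : ∀ k, k ∉ U → ∀ l, M k l = 0)
    (hM' : ∀ k, k ∉ U → ∀ l, M' k l = 0)
    (h : wedgeMatrix (Pi.single i 1 + z) (Pi.single j a + w) + M =
      wedgeMatrix (Pi.single i 1 + z') (Pi.single j a' + w') + M') :
    a = a' ∧ z = z' ∧ w = w' ∧ M = M' := by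
  rw [mem_vectorsOn] at hz hz' hw hw'
  have happ : ∀ k l, _ := fun k l => congrFun (congrFun h k) l
  simp only [Matrix.add_apply, wedgeMatrix_apply, Pi.add_apply] at happ
  have haa : a = a' := by
    simpa [hz i hi, hz' i hi, hw i hi, hw' i hi, hz j hj, hz' j hj, hw j hj, hw' j hj, hM i hi,
      hM' i hi, hij, hij.symm] using happ i j
  subst haa
  have hww : w = w' := by
    funext l
    simpa [hz i hi, hz' i hi, hw i hi, hw' i hi, hM i hi, hM' i hi, hij] using happ i l
  subst hww
  have hzz : z = z' := by
    funext l
    simpa [hz j hj, hz' j hj, hw j hj, hw' j hj, hM j hj, hM' j hj, hij.symm, ha] using happ j l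
  subst hzz
  exact ⟨rfl, rfl, rfl, add_left_cancel h⟩

/-- One fixed pivot already yields enough matrices. The only loss per step is that the pivot entry
is non-zero: `q - 1` choices in place of `q`, a factor of at most two. -/
theorem le_card_altRankLE (u s : ℕ) : ∀ T : Finset (Fin n), T.card = 2 * s + u →
    Fintype.card F ^ altRankDim u s ≤ 2 ^ s * (altRankLE F T (2 * s)).card := by
  classical
  induction s with
  | zero =>
    intro T _
    have : (0 : Matrix (Fin n) (Fin n) F) ∈ altRankLE F T 0 := by
      rw [mem_altRankLE]
      exact ⟨Submodule.zero_mem _, by simp, by simp⟩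
    simpa [altRankDim] using Finset.card_pos.2 ⟨_, this⟩
  | succ s ih =>
    intro T hT
    obtain ⟨i, hi, j, hj, hij⟩ := Finset.one_lt_card.1 (by omega : 1 < T.card)
    have hc := card_erase_erase hi hj hij
    set U := (T.erase i).erase j with hU
    have hiU : i ∉ U := by simp [hU]
    have hjU : j ∉ U := by simp [hU]
    have hTU : ∀ k, k ∉ T → k ∉ U ∧ k ≠ i ∧ k ≠ j := fun k hk =>
      ⟨fun h => hk (Finset.mem_of_mem_erase (Finset.mem_of_mem_erase h)),
        fun h => hk (h ▸ hi), fun h => hk (h ▸ hj)⟩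
    set q := Fintype.card F with hq
    have hq1 : 1 < q := Fintype.one_lt_card
    have hcard : (q - 1) * (q ^ (2 * s + u) * (q ^ (2 * s + u) * (altRankLE F U (2 * s)).card)) ≤
        (altRankLE F T (2 * (s + 1))).card := by
      have hq' : q - 1 = ((Finset.univ : Finset F).erase 0).card := by
        rw [Finset.card_erase_of_mem (Finset.mem_univ _), Finset.card_univ]
      rw [show 2 * s + u = U.card by omega, ← card_vectorsOn, hq', ← Finset.card_product,
        ← Finset.card_product, ← Finset.card_product]
      refine Finset.card_le_card_of_injOn (fun p => wedgeMatrix (Pi.single i 1 + p.2.1)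
        (Pi.single j p.1 + p.2.2.1) + p.2.2.2) ?_ ?_
      · rintro ⟨a, z, w, M⟩ hp
        simp only [Finset.coe_product, Set.mem_prod, Finset.mem_coe, mem_altRankLE,
          mem_vectorsOn] at hp
        obtain ⟨-, hz, hw, hM, hM0, hMr⟩ := hp
        rw [Finset.mem_coe, mem_altRankLE]
        refine ⟨Submodule.add_mem _ (wedgeMatrix_mem_altMatrices _ _) hM, fun k hk l => ?_,
          (rank_wedgeMatrix_add_le _ _ _).trans (by dsimp only; omega)⟩
        obtain ⟨hkU, hki, hkj⟩ := hTU k hk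
        simp [wedgeMatrix_apply, hki, hkj, hz k hkU, hw k hkU, hM0 k hkU]
      · rintro ⟨a, z, w, M⟩ hp ⟨a', z', w', M'⟩ hp' h
        simp only [Finset.coe_product, Set.mem_prod, Finset.mem_coe, mem_altRankLE,
          Finset.mem_erase, Finset.mem_univ, and_true] at hp hp'
        obtain ⟨ha, hz, hw, -, hM, -⟩ := hp
        obtain ⟨-, hz', hw', -, hM', -⟩ := hp'
        obtain ⟨rfl, rfl, rfl, rfl⟩ :=
          wedgeMatrix_add_injective hij hiU hjU ha hz hz' hw hw' hM hM' h
        rfl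
    have hih := ih U (by omega)
    have hq2 : q ≤ 2 * (q - 1) := by omega
    calc q ^ altRankDim u (s + 1)
        = q * (q ^ (2 * s + u) * (q ^ (2 * s + u) * q ^ altRankDim u s)) := by
          rw [altRankDim]; ring
      _ ≤ (2 * (q - 1)) * (q ^ (2 * s + u) * (q ^ (2 * s + u) *
          (2 ^ s * (altRankLE F U (2 * s)).card))) := by gcongr
      _ = 2 ^ (s + 1) * ((q - 1) * (q ^ (2 * s + u) * (q ^ (2 * s + u) *
          (altRankLE F U (2 * s)).card))) := by ring
      _ ≤ _ := Nat.mul_le_mul_left _ hcard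

end RankCount

/-! ### Dimension of the space of alternating matrices. -/

section AltDimension

variable (F : Type*) [Field F] (n : ℕ)

/-- An alternating matrix is determined by its entries above the diagonal. -/
noncomputable def altMatricesEquiv :
    altMatrices F n ≃ₗ[F] ((Σ j : Fin n, Fin j) → F) where
  toFun M p := (M : Matrix (Fin n) (Fin n) F) ⟨p.2, p.2.2.trans p.1.2⟩ p.1
  map_add' _ _ := rfl
  map_smul' _ _ := rfl
  invFun f := ⟨Matrix.of fun k l =>
      if h : k < l then f ⟨l, ⟨k, h⟩⟩ else if h : l < k then -f ⟨k, ⟨l, h⟩⟩ else 0, by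
    refine mem_altMatrices.2 ⟨fun k l => ?_, fun k => by simp⟩
    rcases lt_trichotomy k l with h | rfl | h
    · simp [h, h.not_gt]
    · simp
    · simp [h, h.not_gt]⟩
  left_inv M := by
    obtain ⟨M, hskew, hdiag⟩ := M
    refine Subtype.ext (Matrix.ext fun k l => ?_)
    rcases lt_trichotomy k l with h | rfl | h
    · simp [h]
    · simp [hdiag]
    · simp [h, h.not_gt, hskew k l]
  right_inv f := by
    funext ⟨l, k⟩
    have h : (⟨k, k.2.trans l.2⟩ : Fin n) < l := k.2
    simp [h]

theorem finrank_altMatrices : Module.finrank F (altMatrices F n) = n * (n - 1) / 2 := by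
  rw [(altMatricesEquiv F n).finrank_eq, Module.finrank_fintype_fun_eq_card, Fintype.card_sigma]
  simp only [Fintype.card_fin]
  rw [Fin.sum_univ_eq_sum_range (fun i => i), Finset.sum_range_id]

theorem cast_finrank_altMatrices :
    (Module.finrank F (altMatrices F n) : ℝ) = (n : ℝ) * (n - 1) / 2 := by
  rw [finrank_altMatrices, Nat.cast_div (Nat.even_mul_pred_self n).two_dvd (by norm_num)]
  cases n <;> simp

end AltDimension

/-! ### Densities of codes as counts of avoiding subspaces. -/

section Density

variable (F : Type*) [Field F] {n : ℕ}

/-- Non-triviality of `C` is essential: for `⊥` the infimum is over the empty set and equals `0`. -/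
theorem le_minDist_iff {C : Submodule F (Matrix (Fin n) (Fin n) F)} (hC : C ≠ ⊥) {d : ℕ} :
    d ≤ minDist C ↔ ∀ M ∈ C, M ≠ 0 → d ≤ M.rank := by
  obtain ⟨M, hM, hM0⟩ := Submodule.exists_mem_ne_zero_of_ne_bot hC
  have hne : {r : ℕ | ∃ M ∈ C, M ≠ 0 ∧ M.rank = r}.Nonempty := ⟨M.rank, M, hM, hM0, rfl⟩
  rw [minDist, le_csInf_iff (OrderBot.bddBelow _) hne]
  constructor
  · intro h M hM hM0
    exact h _ ⟨M, hM, hM0, rfl⟩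
  · rintro h _ ⟨M, hM, hM0, rfl⟩
    exact h M hM hM0

variable [Fintype F]

noncomputable instance altMatricesFintype : Fintype (altMatrices F n) := Fintype.ofFinite _

open Classical in
/-- The nonzero alternating matrices of rank less than `d`. -/
noncomputable def lowRankAlt (n d : ℕ) : Finset (altMatrices F n) :=
  Finset.univ.filter fun v => v ≠ 0 ∧ (v : Matrix (Fin n) (Fin n) F).rank < d

variable {F} in
theorem mem_lowRankAlt {d : ℕ} {v : altMatrices F n} :
    v ∈ lowRankAlt F n d ↔ v ≠ 0 ∧ (v : Matrix (Fin n) (Fin n) F).rank < d := by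
  simp [lowRankAlt]

theorem card_lowRankAlt_add_one (n r : ℕ) :
    (lowRankAlt F n (r + 1)).card + 1 = (altRankLE F (Finset.univ : Finset (Fin n)) r).card := by
  classical
  have h0 : (0 : altMatrices F n) ∉ lowRankAlt F n (r + 1) := fun h => (mem_lowRankAlt.1 h).1 rfl
  rw [← Finset.card_insert_of_notMem h0]
  refine Finset.card_bij (fun v _ => (v : Matrix (Fin n) (Fin n) F)) ?_ ?_ ?_
  · intro v hv
    rw [mem_altRankLE]
    refine ⟨v.2, by simp, ?_⟩
    rcases Finset.mem_insert.1 hv with rfl | hv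
    · simp
    · exact Nat.lt_succ_iff.1 (mem_lowRankAlt.1 hv).2
  · intro v _ w _ h
    exact Subtype.ext h
  · intro M hM
    rw [mem_altRankLE] at hM
    refine ⟨⟨M, hM.1⟩, ?_, rfl⟩
    rw [Finset.mem_insert, mem_lowRankAlt]
    by_cases h : (⟨M, hM.1⟩ : altMatrices F n) = 0
    · exact Or.inl h
    · exact Or.inr ⟨h, Nat.lt_succ_iff.2 hM.2.2⟩

open Classical in
theorem altCodes_eq_image {k : ℕ} (hk : 1 ≤ k) :
    altCodes F n k = Submodule.map (altMatrices F n).subtype ''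
      (grassmannian F (altMatrices F n) k : Set (Submodule F (altMatrices F n))) := by
  ext C
  simp only [altCodes, IsAltCode, Set.mem_image, Finset.mem_coe, mem_grassmannian,
    Set.mem_ofPred_eq]
  constructor
  · rintro ⟨⟨-, hC⟩, hCk⟩
    have hmap : (C.comap (altMatrices F n).subtype).map (altMatrices F n).subtype = C := by
      rw [Submodule.map_comap_subtype, inf_eq_right.2 hC]
    refine ⟨C.comap (altMatrices F n).subtype, ?_, hmap⟩
    rw [← hCk, ← congrArg (fun D : Submodule F _ => Module.finrank F D) hmap]
    exact (Submodule.finrank_map_subtype_eq _ _).symm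
  · rintro ⟨C, hC, rfl⟩
    have hfr : Module.finrank F (C.map (altMatrices F n).subtype) = k := by
      rw [Submodule.finrank_map_subtype_eq, hC]
    refine ⟨⟨fun h => ?_, Submodule.map_subtype_le _ _⟩, hfr⟩
    rw [h, finrank_bot] at hfr
    omega

theorem ncard_altCodes {k : ℕ} (hk : 1 ≤ k) :
    (altCodes F n k).ncard = (grassmannian F (altMatrices F n) k).card := by
  classical
  rw [altCodes_eq_image F hk, Set.ncard_image_of_injective _
    (Submodule.map_injective_of_injective (altMatrices F n).injective_subtype), Set.ncard_coe_finset]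

theorem ncard_altCodes_le_minDist {k : ℕ} (hk : 1 ≤ k) (d : ℕ) :
    {C ∈ altCodes F n k | d ≤ minDist C}.ncard = (avoiding F k (lowRankAlt F n d)).card := by
  classical
  have : {C ∈ altCodes F n k | d ≤ minDist C} = Submodule.map (altMatrices F n).subtype ''
      (avoiding F k (lowRankAlt F n d) : Set (Submodule F (altMatrices F n))) := by
    ext C
    constructor
    · rintro ⟨hC, hd⟩
      have hne : C ≠ ⊥ := hC.1.1
      rw [altCodes_eq_image F hk] at hC
      obtain ⟨C, hC, rfl⟩ := hC
      refine ⟨C, mem_avoiding.2 ⟨mem_grassmannian.1 hC, fun v hv hvC => ?_⟩, rfl⟩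
      obtain ⟨hv0, hvr⟩ := mem_lowRankAlt.1 hv
      exact hvr.not_ge ((le_minDist_iff F hne).1 hd v ⟨v, hvC, rfl⟩ (by simpa using hv0))
    · rintro ⟨C, hC, rfl⟩
      obtain ⟨hC, hav⟩ := mem_avoiding.1 hC
      have hmem : C.map (altMatrices F n).subtype ∈ altCodes F n k := by
        rw [altCodes_eq_image F hk]; exact ⟨C, mem_grassmannian.2 hC, rfl⟩
      refine ⟨hmem, (le_minDist_iff F hmem.1.1).2 ?_⟩
      rintro _ ⟨v, hvC, rfl⟩ hv0
      by_contra hlt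
      exact hav v (mem_lowRankAlt.2 ⟨fun h => hv0 (by simp [h]), not_le.1 hlt⟩) hvC
  rw [this, Set.ncard_image_of_injective _
    (Submodule.map_injective_of_injective (altMatrices F n).injective_subtype), Set.ncard_coe_finset]

omit [Fintype F] in
theorem altDensity_nonneg (n k d : ℕ) : 0 ≤ altDensity F n k d := by
  unfold altDensity; positivity

theorem altDensity_le_one (n k d : ℕ) : altDensity F n k d ≤ 1 :=
  div_le_one_of_le₀ (Nat.cast_le.2 (Set.ncard_le_ncard (Set.sep_subset _ _) (Set.toFinite _)))
    (Nat.cast_nonneg _)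

omit [Fintype F] in
theorem altMRDDensity_nonneg (n k d : ℕ) : 0 ≤ altMRDDensity F n k d := by
  unfold altMRDDensity; positivity

theorem altMRDDensity_le_altDensity (n k d : ℕ) : altMRDDensity F n k d ≤ altDensity F n k d :=
  div_le_div_of_nonneg_right (Nat.cast_le.2 (Set.ncard_le_ncard
    (fun _ hC => ⟨hC.1, hC.2.2.ge⟩) (Set.toFinite _))) (Nat.cast_nonneg _)

theorem altDensity_eq {k : ℕ} (hk : 1 ≤ k) (d : ℕ) :
    altDensity F n k d = (avoiding F k (lowRankAlt F n d)).card /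
      (grassmannian F (altMatrices F n) k).card := by
  rw [altDensity, ncard_altCodes F hk, ncard_altCodes_le_minDist F hk]

theorem altDensity_mul_le {k : ℕ} (hk : 1 ≤ k) (hkN : k ≤ Module.finrank F (altMatrices F n))
    (d : ℕ) :
    altDensity F n k d * ((lowRankAlt F n d).card * ((Fintype.card F : ℝ) ^ k - 1)) ≤
      ((Fintype.card F : ℝ) - 1) *
        ((Fintype.card F : ℝ) ^ Module.finrank F (altMatrices F n) - 1) := by
  classical
  have hS : (0 : ℝ) < (grassmannian F (altMatrices F n) k).card :=
    Nat.cast_pos.2 (grassmannian_nonempty hkN).card_pos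
  rw [altDensity_eq F hk, div_mul_eq_mul_div, div_le_iff₀ hS, mul_comm (_ * _) (Finset.card _ : ℝ)]
  exact second_moment_bound hkN (by omega) fun v hv => (mem_lowRankAlt.1 hv).1

theorem one_sub_altDensity_mul_le {k : ℕ} (hk : 1 ≤ k)
    (hkN : k ≤ Module.finrank F (altMatrices F n)) (d : ℕ) :
    (1 - altDensity F n k d) * (((Fintype.card F : ℝ) - 1) *
        ((Fintype.card F : ℝ) ^ Module.finrank F (altMatrices F n) - 1)) ≤
      (lowRankAlt F n d).card * ((Fintype.card F : ℝ) ^ k - 1) := by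
  classical
  have hS : (0 : ℝ) < (grassmannian F (altMatrices F n) k).card :=
    Nat.cast_pos.2 (grassmannian_nonempty hkN).card_pos
  have h := first_moment_bound (K := F) k (B := lowRankAlt F n d)
    (fun v hv => (mem_lowRankAlt.1 hv).1) fun v hv c hc => by
      rw [mem_lowRankAlt] at hv ⊢
      refine ⟨smul_ne_zero hc hv.1, ?_⟩
      rw [Submodule.coe_smul, Matrix.rank_smul_of_mem_nonZeroDivisors _
        (mem_nonZeroDivisors_of_ne_zero hc)]
      exact hv.2
  refine le_of_mul_le_mul_left ?_ hS
  refine le_trans (le_of_eq ?_) h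
  rw [altDensity_eq F hk]
  field_simp

variable {F}

/-- The ratio comparing the expected number of low-rank lines in a random code with `1`. -/
theorem altDensity_exponent_identity {s u k : ℕ} (hn : n = 2 * s + u) :
    (Fintype.card F : ℝ) ^ Module.finrank F (altMatrices F n) * Fintype.card F =
      (Fintype.card F : ℝ) ^ (altThreshold n (2 * s + 2) - k) *
        ((Fintype.card F : ℝ) ^ altRankDim u s * (Fintype.card F : ℝ) ^ k) := by
  have hq : (0 : ℝ) < Fintype.card F := Nat.cast_pos.2 Fintype.card_pos
  rw [← Real.rpow_natCast _ k, ← Real.rpow_natCast _ (altRankDim u s), ← Real.rpow_add hq,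
    ← Real.rpow_add hq, ← Real.rpow_natCast _ (Module.finrank F _), ← Real.rpow_add_one hq.ne']
  congr 1
  have hE : (altRankDim u s : ℝ) + s = 2 * s * (s + u) := by exact_mod_cast altRankDim_add u s
  rw [cast_finrank_altMatrices, altThreshold, eq_sub_of_add_eq hE, hn]
  push_cast
  ring

theorem card_univ_eq {s u : ℕ} (hn : n = 2 * s + u) :
    (Finset.univ : Finset (Fin n)).card = 2 * s + u := by simp [hn]

/-- The first moment bound combined with the upper count of low-rank matrices; it settles the case
below the threshold. -/
theorem one_sub_altDensity_mul_rpow_le {s u k : ℕ} (hn : n = 2 * s + u) (hk : 1 ≤ k)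
    (hkN : k ≤ Module.finrank F (altMatrices F n)) :
    (1 - altDensity F n k (2 * s + 2)) *
      (Fintype.card F : ℝ) ^ (altThreshold n (2 * s + 2) - k) ≤ 4 * ((n : ℝ) ^ 2 + 1) ^ s := by
  have hq : (2 : ℝ) ≤ Fintype.card F := by exact_mod_cast Fintype.one_lt_card (α := F)
  have h1 := one_sub_altDensity_mul_le F hk hkN (2 * s + 2)
  have hid := altDensity_exponent_identity (F := F) (k := k) hn
  have hB : ((lowRankAlt F n (2 * s + 2)).card : ℝ) ≤
      ((n : ℝ) ^ 2 + 1) ^ s * (Fintype.card F : ℝ) ^ altRankDim u s := by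
    have := (card_lowRankAlt_add_one F n (2 * s + 1)).le.trans
      (card_altRankLE_le u s Finset.univ (card_univ_eq hn))
    exact_mod_cast (Nat.le_succ _).trans this
  have hδ : 0 ≤ 1 - altDensity F n k (2 * s + 2) := sub_nonneg.2 (altDensity_le_one F n k _)
  have hN : 2 ≤ (Fintype.card F : ℝ) ^ Module.finrank F (altMatrices F n) :=
    hq.trans (le_self_pow₀ (by linarith) (by omega))
  have hk0 : 0 < (Fintype.card F : ℝ) ^ k := by positivity
  have hE0 : 0 < (Fintype.card F : ℝ) ^ altRankDim u s := by positivity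
  set q : ℝ := (Fintype.card F : ℝ) with hqdef
  set Q := q ^ Module.finrank F (altMatrices F n)
  set δ := 1 - altDensity F n k (2 * s + 2)
  refine le_of_mul_le_mul_right ?_ (mul_pos hE0 hk0)
  -- Both `q` and `Q` are at least `2`, so subtracting one at most halves each.
  have h2 : Q * q / 4 ≤ (q - 1) * (Q - 1) := by nlinarith
  calc δ * q ^ (altThreshold n (2 * s + 2) - k) * (q ^ altRankDim u s * q ^ k)
      = 4 * (δ * (Q * q / 4)) := by rw [hid]; ring
    _ ≤ 4 * (δ * ((q - 1) * (Q - 1))) := by gcongr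
    _ ≤ 4 * ((lowRankAlt F n (2 * s + 2)).card * (q ^ k - 1)) := by gcongr
    _ ≤ 4 * ((((n : ℝ) ^ 2 + 1) ^ s * q ^ altRankDim u s) * q ^ k) := by
        refine mul_le_mul_of_nonneg_left (mul_le_mul hB (by linarith) ?_ (by positivity)) (by norm_num)
        exact sub_nonneg.2 (one_le_pow₀ (by linarith))
    _ = _ := by ring

/-- The second moment bound combined with the lower count. For `s = 0` there is no non-zero
alternating matrix of rank below `2`, hence `1 ≤ s`. The constant collects `2^(s+1)` from the count
and `2` from `q^k ≤ 2(q^k - 1)`. -/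
theorem altDensity_le_mul_rpow {s u k : ℕ} (hs : 1 ≤ s) (hn : n = 2 * s + u)
    (hk : 1 ≤ k) (hkN : k ≤ Module.finrank F (altMatrices F n))
    (hq2 : 2 ^ (s + 1) ≤ Fintype.card F) :
    altDensity F n k (2 * s + 2) ≤
      2 ^ (s + 2) * (Fintype.card F : ℝ) ^ (altThreshold n (2 * s + 2) - k) := by
  have hq : (2 : ℝ) ≤ Fintype.card F := by exact_mod_cast Fintype.one_lt_card (α := F)
  have h1 := altDensity_mul_le F hk hkN (2 * s + 2)
  have hid := altDensity_exponent_identity (F := F) (k := k) hn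
  have hE : altRankDim u s ≠ 0 := by
    obtain ⟨s, rfl⟩ := Nat.exists_eq_add_of_le' hs
    simp [altRankDim]
  have hB : (Fintype.card F : ℝ) ^ altRankDim u s ≤
      2 ^ (s + 1) * (lowRankAlt F n (2 * s + 2)).card := by
    have hmono : (altRankLE F (Finset.univ : Finset (Fin n)) (2 * s)).card ≤
        (altRankLE F (Finset.univ : Finset (Fin n)) (2 * s + 1)).card := by
      refine Finset.card_le_card fun M hM => ?_
      rw [mem_altRankLE] at hM ⊢
      exact ⟨hM.1, hM.2.1, hM.2.2.trans (Nat.le_succ _)⟩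
    rw [← card_lowRankAlt_add_one F n (2 * s + 1)] at hmono
    have h2 := (le_card_altRankLE (F := F) u s Finset.univ (card_univ_eq hn)).trans
      (Nat.mul_le_mul_left _ hmono)
    -- The count includes the zero matrix; for `q` this large it is absorbed by doubling the
    -- constant.
    have h3 : 2 ^ (s + 1) ≤ Fintype.card F ^ altRankDim u s :=
      hq2.trans (Nat.le_self_pow hE _)
    have h4 : Fintype.card F ^ altRankDim u s ≤
        2 ^ (s + 1) * (lowRankAlt F n (2 * s + 2)).card := by
      rw [pow_succ] at h3 ⊢
      nlinarith
    exact_mod_cast h4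
  have hkq : (2 : ℝ) ≤ (Fintype.card F : ℝ) ^ k := hq.trans (le_self_pow₀ (by linarith) (by omega))
  have hE0 : 0 < (Fintype.card F : ℝ) ^ altRankDim u s := by positivity
  have hN : 1 ≤ (Fintype.card F : ℝ) ^ Module.finrank F (altMatrices F n) :=
    one_le_pow₀ (by linarith)
  set q : ℝ := (Fintype.card F : ℝ) with hqdef
  set Q := q ^ Module.finrank F (altMatrices F n)
  set b : ℝ := ((lowRankAlt F n (2 * s + 2)).card : ℝ) with hbdef
  have hb : 0 < b := pos_of_mul_pos_right (hE0.trans_le hB) (by positivity)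
  have hc : 0 < q ^ (altThreshold n (2 * s + 2) - k) := Real.rpow_pos_of_pos (by linarith) _
  refine le_of_mul_le_mul_right ?_ (mul_pos hb (by linarith : 0 < q ^ k - 1))
  calc _ ≤ (q - 1) * (Q - 1) := h1
    _ ≤ Q * q := by nlinarith
    _ = q ^ (altThreshold n (2 * s + 2) - k) * (q ^ altRankDim u s * q ^ k) := hid
    _ ≤ q ^ (altThreshold n (2 * s + 2) - k) * ((2 ^ (s + 1) * b) * (2 * (q ^ k - 1))) := by
        gcongr
        linarith
    _ = _ := by ring

end Density

/-! ### Comparison of the dimension bound, the ambient dimension and the threshold. -/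

section Bounds

theorem altBound_le {n e : ℕ} (he : 1 ≤ e) (hn : 2 * e ≤ n) :
    altBound n e ≤ (n : ℝ) * (n - 1) / 2 := by
  have ht : (1 : ℝ) ≤ (n / 2 : ℕ) := by exact_mod_cast (by omega : 1 ≤ n / 2)
  have he' : (1 : ℝ) ≤ e := by exact_mod_cast he
  have hn' : (1 : ℝ) ≤ n := by exact_mod_cast (by omega : 1 ≤ n)
  have h0 : 0 ≤ (n : ℝ) * (n - 1) := mul_nonneg (by linarith) (by linarith)
  rw [altBound]
  calc _ ≤ (n : ℝ) * (n - 1) / (2 * ((n / 2 : ℕ) : ℝ)) * ((n / 2 : ℕ) : ℝ) := by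
        gcongr; linarith
    _ = _ := by field_simp

/-- In both parities of `n` the difference is `2(e-1)(t-e+1) - 1`, which is positive for `2 ≤ e ≤ t`
and equals `-1` for `e = 1`. -/
theorem altThreshold_lt_altBound {n e : ℕ} (he : 2 ≤ e) (hn : 2 * e ≤ n) :
    altThreshold n (2 * e) < altBound n e := by
  obtain ⟨t, ht⟩ : ∃ t, n / 2 = t := ⟨_, rfl⟩
  have het : (e : ℝ) ≤ t := by exact_mod_cast (by omega : e ≤ t)
  have he' : (2 : ℝ) ≤ e := by exact_mod_cast he
  have ht0 : (t : ℝ) ≠ 0 := by linarith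
  rw [altThreshold, altBound, ht]
  have hprod : 0 ≤ ((e : ℝ) - 2) * (t - e) := mul_nonneg (by linarith) (by linarith)
  rcases Nat.mod_two_eq_zero_or_one n with h | h
  · have hnt : (n : ℝ) = 2 * t := by exact_mod_cast (by omega : n = 2 * t)
    rw [hnt, (by field_simp : (2 * (t : ℝ) * (2 * t - 1)) / (2 * t) = 2 * t - 1)]
    push_cast
    nlinarith
  · have hnt : (n : ℝ) = 2 * t + 1 := by exact_mod_cast (by omega : n = 2 * t + 1)
    rw [hnt, (by field_simp; ring : ((2 * (t : ℝ) + 1) * (2 * t + 1 - 1)) / (2 * t) = 2 * t + 1)]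
    push_cast
    nlinarith

theorem altBound_pos {n e : ℕ} (he : 1 ≤ e) (hn : 2 * e ≤ n) : 0 < altBound n e := by
  have het : (e : ℝ) ≤ (n / 2 : ℕ) := by exact_mod_cast (by omega : e ≤ n / 2)
  have he' : (1 : ℝ) ≤ e := by exact_mod_cast he
  have hn' : (2 : ℝ) ≤ n := by exact_mod_cast (by omega : 2 ≤ n)
  exact mul_pos (div_pos (mul_pos (by linarith) (by linarith)) (by linarith)) (by linarith)

instance primePowerNonempty : Nonempty PrimePower := ⟨⟨2, Nat.prime_two.isPrimePow⟩⟩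

theorem tendsto_primePower_cast :
    Tendsto (fun q : PrimePower => ((q : ℕ) : ℝ)) atTop atTop := by
  refine tendsto_natCast_atTop_atTop.comp (tendsto_atTop_atTop.2 fun b => ?_)
  obtain ⟨p, hbp, hp⟩ := Nat.exists_infinite_primes b
  exact ⟨⟨p, hp.isPrimePow⟩, fun q hq => hbp.trans hq⟩

end Bounds

/-! ### Asymptotics as `q` grows. -/

theorem theorem6p11
    -- for every prime power `q`, a field `F q` with `q` elements
    (F : PrimePower → Type*) [∀ q, Field (F q)] (hF : ∀ q, Nat.card (F q) = (q : ℕ))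
    (n d e : ℕ) (hd : d = 2 * e) (hd2 : 2 ≤ d) (hdn : d ≤ n) :
    (∀ k : ℕ, 1 ≤ k → (k : ℝ) ≤ altBound n e →
      ((fun q : PrimePower => altDensity (F q) n k d) =O[atTop]
        fun q : PrimePower => ((q : ℕ) : ℝ) ^
          ((n : ℝ) * (n - 1) / 2 - k + 1 - ((d : ℝ) - 2) * n
            + ((d : ℝ) - 1) * ((d : ℝ) - 2) / 2)) ∧
      ((k : ℝ) < altThreshold n d →
        Tendsto (fun q : PrimePower => altDensity (F q) n k d) atTop (𝓝 1)) ∧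
      (altThreshold n d < (k : ℝ) →
        Tendsto (fun q : PrimePower => altDensity (F q) n k d) atTop (𝓝 0))) ∧
    (4 ≤ d → ∀ k : ℕ, (k : ℝ) = altBound n e →
      Tendsto (fun q : PrimePower => altDensity (F q) n k d) atTop (𝓝 0) ∧
      Tendsto (fun q : PrimePower => altMRDDensity (F q) n k d) atTop (𝓝 0)) := by
  have hfin : ∀ q, Finite (F q) := fun q =>
    Nat.finite_of_card_ne_zero (by rw [hF]; exact q.2.ne_zero)
  let _ : ∀ q, Fintype (F q) := fun q => Fintype.ofFinite _
  have hcard : ∀ q : PrimePower, Fintype.card (F q) = (q : ℕ) := fun q => by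
    rw [← Nat.card_eq_fintype_card, hF]
  have he : 1 ≤ e := by omega
  -- From here `e = s + 1`: the matrices to be avoided are those of rank at most `2s`.
  obtain ⟨s, rfl⟩ := Nat.exists_eq_add_of_le' he
  obtain ⟨u, hu⟩ : ∃ u, n = 2 * s + u := ⟨n - 2 * s, by omega⟩
  have hds : d = 2 * s + 2 := by omega
  have hdn' : 2 * (s + 1) ≤ n := by omega
  subst hds
  have hkN : ∀ k : ℕ, (k : ℝ) ≤ altBound n (s + 1) →
      ∀ q, k ≤ Module.finrank (F q) (altMatrices (F q) n) := fun k hk q => by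
    rw [← Nat.cast_le (α := ℝ), cast_finrank_altMatrices]
    exact hk.trans (altBound_le he hdn')
  have hO : ∀ k : ℕ, 1 ≤ k → (k : ℝ) ≤ altBound n (s + 1) →
      (fun q : PrimePower => altDensity (F q) n k (2 * s + 2)) =O[atTop]
        fun q : PrimePower => ((q : ℕ) : ℝ) ^ (altThreshold n (2 * s + 2) - k) := by
    intro k hk hkb
    refine IsBigO.of_bound (2 ^ (s + 2)) ?_
    filter_upwards [tendsto_primePower_cast.eventually_ge_atTop (2 ^ (s + 1))] with q hq
    have hq0 : (0 : ℝ) ≤ ((q : ℕ) : ℝ) := Nat.cast_nonneg _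
    rw [Real.norm_of_nonneg (altDensity_nonneg _ _ _ _),
      Real.norm_of_nonneg (Real.rpow_nonneg hq0 _)]
    rcases Nat.eq_zero_or_pos s with rfl | hs
    -- For `d = 2` the threshold is `N + 1`, above every admissible `k`, so the claimed bound is at
    -- least one and holds trivially.
    · refine (altDensity_le_one (F q) _ _ _).trans ?_
      have hexp : 0 ≤ altThreshold n (2 * 0 + 2) - k := by
        have := hkb.trans (altBound_le he hdn')
        rw [altThreshold]
        push_cast
        nlinarith
      have hq1 : (1 : ℝ) ≤ ((q : ℕ) : ℝ) := le_trans (by norm_num) hq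
      have := Real.one_le_rpow hq1 hexp
      exact one_le_mul_of_one_le_of_one_le (by norm_num) this
    · have hq' : 2 ^ (s + 1) ≤ Fintype.card (F q) := by rw [hcard]; exact_mod_cast hq
      have := altDensity_le_mul_rpow hs hu hk (hkN k hkb q) hq'
      rwa [hcard] at this
  have hzero : ∀ k : ℕ, 1 ≤ k → (k : ℝ) ≤ altBound n (s + 1) →
      altThreshold n (2 * s + 2) < (k : ℝ) →
      Tendsto (fun q : PrimePower => altDensity (F q) n k (2 * s + 2)) atTop (𝓝 0) := by
    intro k hk hkb hlt
    refine (hO k hk hkb).trans_tendsto ?_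
    have := (tendsto_rpow_neg_atTop (sub_pos.2 hlt)).comp tendsto_primePower_cast
    simpa only [Function.comp_def, neg_sub] using this
  refine ⟨fun k hk hkb => ⟨?_, fun hlt => ?_, hzero k hk hkb⟩, fun h4 k hk => ?_⟩
  · convert hO k hk hkb using 4
    rw [altThreshold]
    ring
  · have hlim : Tendsto (fun q : PrimePower => 4 * ((n : ℝ) ^ 2 + 1) ^ s *
        ((q : ℕ) : ℝ) ^ (-(altThreshold n (2 * s + 2) - k))) atTop (𝓝 0) := by
      simpa using ((tendsto_rpow_neg_atTop (sub_pos.2 hlt)).comp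
        tendsto_primePower_cast).const_mul (4 * ((n : ℝ) ^ 2 + 1) ^ s)
    have hsub : Tendsto (fun q : PrimePower => 1 - altDensity (F q) n k (2 * s + 2)) atTop
        (𝓝 0) := by
      refine squeeze_zero (fun q => sub_nonneg.2 (altDensity_le_one (F q) _ _ _)) (fun q => ?_) hlim
      have hq0 : (0 : ℝ) < ((q : ℕ) : ℝ) := Nat.cast_pos.2 q.2.pos
      have := one_sub_altDensity_mul_rpow_le hu hk (hkN k hkb q)
      rw [hcard] at this
      rwa [Real.rpow_neg hq0.le, ← div_eq_mul_inv, le_div_iff₀ (Real.rpow_pos_of_pos hq0 _)]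
    simpa using hsub.const_sub 1
  -- Positivity of `k` is not assumed here; it follows from that of the MRD dimension.
  · have hk1 : 1 ≤ k := by
      have := altBound_pos he hdn'
      rw [← hk] at this
      exact_mod_cast this
    have h0 := hzero k hk1 hk.le (by
      rw [hk, show 2 * s + 2 = 2 * (s + 1) by ring]
      exact altThreshold_lt_altBound (by omega) hdn')
    exact ⟨h0, squeeze_zero (fun q => altMRDDensity_nonneg (F q) _ _ _)
      (fun q => altMRDDensity_le_altDensity (F q) _ _ _) h0⟩
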